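/- Let $E$ be a Banach space over $\mathbb K=\mathbb R$ or $\mathbb C$, with dual $E'$, let $1<p,q<\infty$ with $\frac1p+\frac1q=1$, and let $(\phi_j)_{j\ge1}$ be a weakly null sequence of unit vectors in $E'$ that satisfies an upper $q$-estimate, i.e. there is $B>0$ with $$\Big\|\sum_{j=1}^k\alpha_j\phi_j\Big\|^q\le B^q\sum_{j=1}^k|\alpha_j|^q\qquad\text{for all }k\text{ and all scalars }\alpha_1,\dots,\alpha_k.$$ Let $n$ be an integer with $n\ge p$. Then: (a) $\ell_\infty$ is isomorphic to a closed subspace of $\mathcal P({}^nE)$, the space of continuous scalar-valued $n$-homogeneous polynomials on $E$ with the norm $\|P\|=\sup_{\|x\|\le1}|P(x)|$. (b) Let $\widehat{\bigotimes}_{n,s,\epsilon}E'$ be the completed injective symmetric tensor product, i.e. the completion of the linear span of the tensors $\phi^n:=\phi\otimes\cdots\otimes\phi$ ($n$ factors, $\phi\in E'$) in the norm $\big\|\sum_i\lambda_i\phi_i^n\big\|=\sup\big\{\big|\sum_i\lambda_i\,x''(\phi_i)^n\big| : x''\in E'',\ \|x''\|\le1\big\}$. There are indices $j_1<j_2<\cdots$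 such that $(\phi_{j_k}^n)_k$ is a basic sequence in $\widehat{\bigotimes}_{n,s,\epsilon}E'$, and $(a_k)_k\mapsto\sum_k a_k\phi_{j_k}^n$ (with unconditional convergence) is an isomorphism of $c_0$ onto the closed linear span of $(\phi_{j_k}^n)_k$. -/

import Mathlib

open Filter Topology
open scoped TensorProduct ENNReal NNReal ZeroAtInfty

/-! ### Continuous homogeneous polynomials -/

section HomogeneousPolynomials

/-- The continuous scalar-valued `n`-homogeneous polynomials on `E`: the functions
`x ↦ A (x, …, x)` with `A` a continuous `n`-linear form. -/
def homPolySubmodule (𝕜 : Type*) [RCLike 𝕜] (n : ℕ) (E : Type*) [NormedAddCommGroup E]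
    [NormedSpace 𝕜 E] : Submodule 𝕜 (E → 𝕜) where
  carrier := {P | ∃ A : ContinuousMultilinearMap 𝕜 (fun _ : Fin n => E) 𝕜,
    ∀ x, P x = A fun _ => x}
  add_mem' := by
    rintro P Q ⟨A, hA⟩ ⟨B, hB⟩
    exact ⟨A + B, fun x => by simp [hA, hB]⟩
  zero_mem' := ⟨0, fun x => by simp⟩
  smul_mem' := by
    rintro c P ⟨A, hA⟩
    exact ⟨c • A, fun x => by simp [hA]⟩

/-- The space `𝒫(ⁿE)` of continuous `n`-homogeneous polynomials (a type synonym, so that it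
carries the norm below and not the topology of pointwise convergence). -/
def HomPoly (𝕜 : Type*) [RCLike 𝕜] (n : ℕ) (E : Type*) [NormedAddCommGroup E]
    [NormedSpace 𝕜 E] : Type _ :=
  ↥(homPolySubmodule 𝕜 n E)

namespace HomPoly

variable {𝕜 : Type*} [RCLike 𝕜] {n : ℕ} {E : Type*} [NormedAddCommGroup E] [NormedSpace 𝕜 E]

noncomputable instance : AddCommGroup (HomPoly 𝕜 n E) :=
  inferInstanceAs (AddCommGroup ↥(homPolySubmodule 𝕜 n E))

noncomputable instance : Module 𝕜 (HomPoly 𝕜 n E) :=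
  inferInstanceAs (Module 𝕜 ↥(homPolySubmodule 𝕜 n E))

instance : CoeFun (HomPoly 𝕜 n E) (fun _ => E → 𝕜) := ⟨fun P => P.1⟩

/-- The supremum norm over the closed unit ball. -/
noncomputable instance : Norm (HomPoly 𝕜 n E) :=
  ⟨fun P => ⨆ x : Metric.closedBall (0 : E) 1, ‖P x‖⟩

theorem norm_def (P : HomPoly 𝕜 n E) : ‖P‖ = ⨆ x : Metric.closedBall (0 : E) 1, ‖P x‖ := rfl

theorem add_apply (P Q : HomPoly 𝕜 n E) (x : E) : (P + Q) x = P x + Q x := rfl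

theorem smul_apply (c : 𝕜) (P : HomPoly 𝕜 n E) (x : E) : (c • P) x = c * P x := rfl

theorem bddAbove (P : HomPoly 𝕜 n E) :
    BddAbove (Set.range fun x : Metric.closedBall (0 : E) 1 => ‖P x‖) := by
  obtain ⟨A, hA⟩ := P.2
  refine ⟨‖A‖, ?_⟩
  rintro _ ⟨⟨x, hx⟩, rfl⟩
  have hx' : ‖x‖ ≤ 1 := by simpa using hx
  have h := A.le_opNorm (fun _ => x)
  simp only [Finset.prod_const, Finset.card_univ, Fintype.card_fin] at h
  calc ‖P.1 x‖ = ‖A fun _ => x‖ := by rw [hA]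
    _ ≤ ‖A‖ * ‖x‖ ^ n := h
    _ ≤ ‖A‖ * 1 := by gcongr; exact pow_le_one₀ (norm_nonneg _) hx'
    _ = ‖A‖ := mul_one _

theorem core : NormedSpace.Core 𝕜 (HomPoly 𝕜 n E) where
  norm_nonneg P := Real.iSup_nonneg fun _ => norm_nonneg _
  norm_smul c P := by
    simp only [norm_def, smul_apply, norm_mul]
    exact (Real.mul_iSup_of_nonneg (norm_nonneg c) _).symm
  norm_triangle P Q := by
    have : Nonempty (Metric.closedBall (0 : E) 1) := ⟨⟨0, by simp⟩⟩
    refine ciSup_le fun x => ?_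
    exact (norm_add_le _ _).trans (add_le_add (le_ciSup P.bddAbove x) (le_ciSup Q.bddAbove x))
  norm_eq_zero_iff P := by
    constructor
    · intro h
      have hball : ∀ x : E, ‖x‖ ≤ 1 → P x = 0 := fun x hx => by
        have := le_ciSup P.bddAbove ⟨x, by simpa using hx⟩
        exact norm_le_zero_iff.1 (this.trans h.le)
      refine Subtype.ext (funext fun x => ?_)
      obtain ⟨A, hA⟩ := P.2
      have hr : (0 : ℝ) < ‖x‖ + 1 := by positivity
      have hc : ((‖x‖ + 1 : ℝ) : 𝕜) ≠ 0 := RCLike.ofReal_ne_zero.2 hr.ne'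
      have h0 : P.1 (((‖x‖ + 1 : ℝ) : 𝕜)⁻¹ • x) = 0 := by
        refine hball _ ?_
        rw [norm_smul, norm_inv, RCLike.norm_ofReal, abs_of_pos hr, inv_mul_le_iff₀ hr]
        linarith
      have h1 : P.1 x = ((‖x‖ + 1 : ℝ) : 𝕜) ^ n * P.1 (((‖x‖ + 1 : ℝ) : 𝕜)⁻¹ • x) := by
        have h2 := A.map_smul_univ (fun _ => ((‖x‖ + 1 : ℝ) : 𝕜)⁻¹) (fun _ => x)
        simp only [Finset.prod_const, Finset.card_univ, Fintype.card_fin, smul_eq_mul] at h2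
        rw [hA, hA, h2, ← mul_assoc, ← mul_pow, mul_inv_cancel₀ hc, one_pow, one_mul]
      rw [h1, h0, mul_zero]
      rfl
    · rintro rfl
      have : ∀ x : E, (0 : HomPoly 𝕜 n E) x = 0 := fun _ => rfl
      simp [norm_def, this]

noncomputable instance : NormedAddCommGroup (HomPoly 𝕜 n E) := NormedAddCommGroup.ofCore core

noncomputable instance : NormedSpace 𝕜 (HomPoly 𝕜 n E) := NormedSpace.ofCore core

end HomPoly

end HomogeneousPolynomials

/-! ### The completed injective symmetric tensor product -/

section InjectiveSymmetricTensorProduct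

/-- The linear form `f ⊗ ⋯ ⊗ f` on the `n`-fold tensor product of `F`; it sends
`x₁ ⊗ ⋯ ⊗ xₙ` to `f x₁ ⋯ f xₙ`. -/
noncomputable def tensorEval {𝕜 : Type*} [RCLike 𝕜] (n : ℕ) {F : Type*} [NormedAddCommGroup F]
    [NormedSpace 𝕜 F] (f : StrongDual 𝕜 F) : (⨂[𝕜] _ : Fin n, F) →ₗ[𝕜] 𝕜 :=
  PiTensorProduct.lift
    ((MultilinearMap.mkPiAlgebra 𝕜 (Fin n) 𝕜).compLinearMap fun _ => (f : F →ₗ[𝕜] 𝕜))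

/-- The algebraic `n`-fold symmetric tensor product of `F`: the span of the tensors
`x ⊗ ⋯ ⊗ x` (a type synonym, so that it carries the injective norm below). -/
def SymTensor (𝕜 : Type*) [RCLike 𝕜] (n : ℕ) (F : Type*) [NormedAddCommGroup F]
    [NormedSpace 𝕜 F] : Type _ :=
  ↥(Submodule.span 𝕜
    (Set.range fun x : F => (PiTensorProduct.tprod 𝕜 fun _ : Fin n => x : ⨂[𝕜] _ : Fin n, F)))

namespace SymTensor

variable {𝕜 : Type*} [RCLike 𝕜] {n : ℕ} {F : Type*} [NormedAddCommGroup F] [NormedSpace 𝕜 F]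

noncomputable instance : AddCommGroup (SymTensor 𝕜 n F) :=
  inferInstanceAs (AddCommGroup ↥(Submodule.span 𝕜
    (Set.range fun x : F => (PiTensorProduct.tprod 𝕜 fun _ : Fin n => x : ⨂[𝕜] _ : Fin n, F))))

noncomputable instance : Module 𝕜 (SymTensor 𝕜 n F) :=
  inferInstanceAs (Module 𝕜 ↥(Submodule.span 𝕜
    (Set.range fun x : F => (PiTensorProduct.tprod 𝕜 fun _ : Fin n => x : ⨂[𝕜] _ : Fin n, F))))

/-- The symmetric tensor `xⁿ = x ⊗ ⋯ ⊗ x`. -/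
def pow (𝕜 : Type*) [RCLike 𝕜] (n : ℕ) {F : Type*} [NormedAddCommGroup F]
    [NormedSpace 𝕜 F] (x : F) : SymTensor 𝕜 n F :=
  ⟨PiTensorProduct.tprod 𝕜 fun _ : Fin n => x, Submodule.subset_span ⟨x, rfl⟩⟩

/-- Evaluation of a symmetric tensor at `f`: the linear form with `xⁿ ↦ (f x) ^ n`. -/
noncomputable def eval (f : StrongDual 𝕜 F) : SymTensor 𝕜 n F →ₗ[𝕜] 𝕜 :=
  (tensorEval n f).comp (Submodule.subtype (Submodule.span 𝕜
    (Set.range fun x : F => (PiTensorProduct.tprod 𝕜 fun _ : Fin n => x : ⨂[𝕜] _ : Fin n, F))))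

theorem eval_pow (f : StrongDual 𝕜 F) (x : F) : eval f (pow 𝕜 n x) = (f x) ^ n := by
  change tensorEval n f (PiTensorProduct.tprod 𝕜 fun _ : Fin n => x) = _
  simp [tensorEval]

/-- The injective norm `sup {|(f ⊗ ⋯ ⊗ f)(u)| : f ∈ F', ‖f‖ ≤ 1}`. -/
noncomputable instance : Norm (SymTensor 𝕜 n F) :=
  ⟨fun u => ⨆ f : Metric.closedBall (0 : StrongDual 𝕜 F) 1, ‖eval f.1 u‖⟩

theorem norm_def (u : SymTensor 𝕜 n F) :
    ‖u‖ = ⨆ f : Metric.closedBall (0 : StrongDual 𝕜 F) 1, ‖eval f.1 u‖ := rfl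

theorem bddAbove (u : SymTensor 𝕜 n F) :
    BddAbove (Set.range fun f : Metric.closedBall (0 : StrongDual 𝕜 F) 1 => ‖eval f.1 u‖) := by
  have key : ∀ v : ⨂[𝕜] _ : Fin n, F, ∃ C : ℝ, ∀ f : StrongDual 𝕜 F, ‖f‖ ≤ 1 →
      ‖tensorEval n f v‖ ≤ C := by
    intro v
    induction v using PiTensorProduct.induction_on with
    | smul_tprod r x =>
      refine ⟨‖r‖ * ∏ i, ‖x i‖, fun f hf => ?_⟩
      simp only [map_smul, smul_eq_mul, norm_mul, tensorEval, PiTensorProduct.lift.tprod,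
        MultilinearMap.compLinearMap_apply, MultilinearMap.mkPiAlgebra_apply, norm_prod]
      gcongr with i
      exact (f.le_opNorm (x i)).trans (mul_le_of_le_one_left (norm_nonneg _) hf)
    | add a b ha hb =>
      obtain ⟨C, hC⟩ := ha
      obtain ⟨D, hD⟩ := hb
      refine ⟨C + D, fun f hf => ?_⟩
      rw [map_add]
      exact (norm_add_le _ _).trans (add_le_add (hC f hf) (hD f hf))
  obtain ⟨C, hC⟩ := key u.1
  refine ⟨C, ?_⟩
  rintro _ ⟨f, rfl⟩
  exact hC f.1 (mem_closedBall_zero_iff.1 f.2)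

theorem core : SeminormedSpace.Core 𝕜 (SymTensor 𝕜 n F) where
  norm_nonneg u := Real.iSup_nonneg fun _ => norm_nonneg _
  norm_smul c u := by
    simp only [norm_def, map_smul, smul_eq_mul, norm_mul]
    exact (Real.mul_iSup_of_nonneg (norm_nonneg c) _).symm
  norm_triangle u v := by
    have : Nonempty (Metric.closedBall (0 : StrongDual 𝕜 F) 1) := ⟨⟨0, by simp⟩⟩
    refine ciSup_le fun f => ?_
    rw [map_add]
    exact (norm_add_le _ _).trans (add_le_add (le_ciSup u.bddAbove f) (le_ciSup v.bddAbove f))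

noncomputable instance : SeminormedAddCommGroup (SymTensor 𝕜 n F) :=
  SeminormedAddCommGroup.ofCore core

noncomputable instance : NormedSpace 𝕜 (SymTensor 𝕜 n F) where
  norm_smul_le c u := (core.norm_smul c u).le

end SymTensor

/-- The `n`-fold symmetric tensor product of `F`, completed in the injective norm. -/
abbrev InjSymTensor (𝕜 : Type*) [RCLike 𝕜] (n : ℕ) (F : Type*) [NormedAddCommGroup F]
    [NormedSpace 𝕜 F] : Type _ :=
  UniformSpace.Completion (SymTensor 𝕜 n F)

/-- The tensor `xⁿ = x ⊗ ⋯ ⊗ x` as an element of the completed tensor product. -/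
noncomputable def InjSymTensor.pow (𝕜 : Type*) [RCLike 𝕜] (n : ℕ) {F : Type*}
    [NormedAddCommGroup F] [NormedSpace 𝕜 F] (x : F) : InjSymTensor 𝕜 n F :=
  ((SymTensor.pow 𝕜 n x : SymTensor 𝕜 n F) : UniformSpace.Completion (SymTensor 𝕜 n F))

end InjectiveSymmetricTensorProduct

/-! ### Sequences in Banach spaces, and embeddings -/

/-- `x` converges to `0` in the weak topology of `F`. -/
def WeaklyNull (𝕜 : Type*) [RCLike 𝕜] {F : Type*} [NormedAddCommGroup F] [NormedSpace 𝕜 F]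
    (x : ℕ → F) : Prop :=
  Tendsto (fun j => toWeakSpace 𝕜 F (x j)) atTop (𝓝 0)

/-- `x` satisfies an upper `q`-estimate:
`‖∑ αⱼ xⱼ‖ ≤ B (∑ |αⱼ| ^ q) ^ (1 / q)` for all finite sequences of scalars. -/
def UpperEstimate (𝕜 : Type*) [RCLike 𝕜] {F : Type*} [NormedAddCommGroup F] [NormedSpace 𝕜 F]
    (q : ℝ) (x : ℕ → F) : Prop :=
  ∃ B : ℝ, 0 < B ∧ ∀ (k : ℕ) (α : ℕ → 𝕜),
    ‖∑ j ∈ Finset.range k, α j • x j‖ ^ q ≤ B ^ q * ∑ j ∈ Finset.range k, ‖α j‖ ^ q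

/-- `x` is a basic sequence: a Schauder basis of its closed linear span. -/
def IsBasicSequence (𝕜 : Type*) [RCLike 𝕜] {F : Type*} [NormedAddCommGroup F] [NormedSpace 𝕜 F]
    (x : ℕ → F) : Prop :=
  ∃ b : SchauderBasis 𝕜 ↥(Submodule.span 𝕜 (Set.range x)).topologicalClosure,
    ∀ j, ((b j : ↥(Submodule.span 𝕜 (Set.range x)).topologicalClosure) : F) = x j

/-- `T` is an isomorphic embedding: an isomorphism onto its range, i.e. bounded below. -/
def IsIsomorphicEmbedding {𝕜 : Type*} [RCLike 𝕜] {X Y : Type*} [NormedAddCommGroup X]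
    [NormedSpace 𝕜 X] [NormedAddCommGroup Y] [NormedSpace 𝕜 Y] (T : X →L[𝕜] Y) : Prop :=
  ∃ c : ℝ, 0 < c ∧ ∀ x, c * ‖x‖ ≤ ‖T x‖

/-!
By duality, the upper `q`-estimate says that `(f (φ j))ⱼ` lies in `ℓ_p`, uniformly for `f` in the
unit ball of `E''`; since `n ≥ p` and `‖φ j‖ = 1`, also `∑ ‖f (φ j)‖ ^ n ≤ C ‖f‖ ^ n`
(`UpperEstimate.exists_sum_pow_le`). Hence `x ↦ ∑ a k * φ k x ^ n` is a continuous polynomial of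
norm at most `C ‖a‖_∞` for every bounded `a`, and finite sums `∑ a k • (φ k)ⁿ` of tensors obey the
same bound, which makes the series unconditionally convergent for `a ∈ c₀`.

For the lower bounds one subsequence serves both parts. A weakly null sequence of unit vectors
stays away from every finite-dimensional subspace, and Hahn–Banach turns the distance of `φ j` to
the span of its predecessors into a point `x` of the unit ball of `E` annihilated by those
predecessors and with `‖φ j x‖ ≥ 1 / 4`. As `∑ ‖φ j x‖ ^ n` converges, passing far enough along the
sequence makes all later functionals negligible at `x` (`WeaklyNull.exists_gliding_hump`). At the
resulting points `x i` the `i`-th term dominates `∑ a k * φ (s k) (x i) ^ n`, so both the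
polynomial and the tensor (evaluated at the image of `x i` in `E''`) have norm at least a constant
times `‖a‖_∞`. In particular no extension of polynomials to the bidual is needed.
-/

/-! ### Weakly null sequences and finite-dimensional subspaces -/

section WeaklyNull

variable {𝕜 : Type*} [RCLike 𝕜] {F : Type*} [NormedAddCommGroup F] [NormedSpace 𝕜 F]

theorem WeaklyNull.tendsto_apply {x : ℕ → F} (h : WeaklyNull 𝕜 x) (f : StrongDual 𝕜 F) :
    Tendsto (fun j => f (x j)) atTop (𝓝 0) := by
  have h1 := (WeakBilin.eval_continuous (topDualPairing 𝕜 F).flip f).tendsto (0 : WeakSpace 𝕜 F)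
  have h2 : Tendsto (fun j => f (x j)) atTop (𝓝 (f 0)) := h1.comp h
  rwa [map_zero] at h2

/-- A weakly null sequence of unit vectors eventually stays away from any given
finite-dimensional subspace: otherwise a subsequence is close to a convergent sequence of that
subspace, whose limit has norm at least `3 / 4`, while every functional of norm at most `1` is at
most `1 / 4` there. -/
theorem WeaklyNull.eventually_lt_norm_sub {x : ℕ → F} (h : WeaklyNull 𝕜 x)
    (hx : ∀ j, ‖x j‖ = 1) (V : Submodule 𝕜 F) [FiniteDimensional 𝕜 V] :
    ∀ᶠ j in atTop, ∀ v ∈ V, 1 / 4 < ‖x j - v‖ := by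
  by_contra hcon
  have hfr : ∃ᶠ j in atTop, ∃ v ∈ V, ‖x j - v‖ ≤ 1 / 4 := by
    intro hev
    exact hcon (hev.mono fun j hj v hv => not_le.1 fun hle => hj ⟨v, hv, hle⟩)
  obtain ⟨σ, hσ, hσV⟩ := extraction_of_frequently_atTop hfr
  choose v hvV hv using hσV
  have : ProperSpace V := FiniteDimensional.proper 𝕜 V
  have hball : ∀ i, (⟨v i, hvV i⟩ : V) ∈ Metric.closedBall (0 : V) (5 / 4) := fun i => by
    have h1 : ‖v i‖ ≤ ‖x (σ i)‖ + ‖x (σ i) - v i‖ := by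
      simpa using norm_sub_le (x (σ i)) (x (σ i) - v i)
    simp only [mem_closedBall_zero_iff, Submodule.coe_norm]
    linarith [hv i, hx (σ i)]
  obtain ⟨w, -, τ, hτ, hlim⟩ := (isCompact_closedBall (0 : V) (5 / 4)).tendsto_subseq hball
  have hlim' : Tendsto (fun i => v (τ i)) atTop (𝓝 (w : F)) :=
    (continuous_subtype_val.tendsto w).comp hlim
  have hw : 3 / 4 ≤ ‖(w : F)‖ := by
    refine ge_of_tendsto' hlim'.norm fun i => ?_
    have := norm_sub_norm_le (x (σ (τ i))) (v (τ i))
    linarith [hv (τ i), hx (σ (τ i))]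
  obtain ⟨g, hg, hgw⟩ := exists_dual_vector'' 𝕜 (w : F)
  have hx0 : Tendsto (fun i => g (x (σ (τ i)))) atTop (𝓝 0) :=
    (h.tendsto_apply g).comp (hσ.comp hτ).tendsto_atTop
  have hgv : Tendsto (fun i => g (v (τ i))) atTop (𝓝 (g w)) := (g.continuous.tendsto _).comp hlim'
  have hle : ‖(0 : 𝕜) - g w‖ ≤ 1 / 4 := by
    refine le_of_tendsto' (hx0.sub hgv).norm fun i => ?_
    rw [← map_sub]
    exact (g.le_opNorm _).trans
      ((mul_le_of_le_one_left (norm_nonneg _) hg).trans (hv (τ i)))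
  rw [zero_sub, norm_neg, hgw, RCLike.norm_ofReal, abs_of_nonneg (norm_nonneg _)] at hle
  linarith

end WeaklyNull

/-! ### Gliding humps for weakly null sequences in a dual space -/

section DualSequences

variable {𝕜 : Type*} [RCLike 𝕜] {E : Type*} [NormedAddCommGroup E] [NormedSpace 𝕜 E]

/-- The norm of `ψ` on the common kernel of finitely many functionals is at least its distance to
their span, by Hahn–Banach. -/
theorem exists_apply_eq_zero_of_lt_norm_sub {ι : Type*} [Fintype ι] (L : ι → StrongDual 𝕜 E)
    (ψ : StrongDual 𝕜 E) {r : ℝ} (hr : 0 ≤ r)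
    (h : ∀ v ∈ Submodule.span 𝕜 (Set.range L), r < ‖ψ - v‖) :
    ∃ x : E, ‖x‖ ≤ 1 ∧ (∀ i, L i x = 0) ∧ r ≤ ‖ψ x‖ := by
  let G : Submodule 𝕜 E := ⨅ i, (L i : E →ₗ[𝕜] 𝕜).ker
  have hG : ∀ {x}, x ∈ G ↔ ∀ i, L i x = 0 := by
    intro x
    simp [G, Submodule.mem_iInf]
  by_contra hcon
  push Not at hcon
  have hbound : ∀ y : G, ‖(ψ.comp G.subtypeL) y‖ ≤ r * ‖y‖ := by
    intro y
    rcases eq_or_ne y 0 with rfl | hy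
    · simp
    have hy' : ‖(y : E)‖ ≠ 0 := by simpa using hy
    have h1 := hcon (((‖(y : E)‖ : 𝕜))⁻¹ • (y : E))
      (by rw [norm_smul, norm_inv, RCLike.norm_ofReal, abs_norm, inv_mul_cancel₀ hy'])
      (fun i => by rw [map_smul, hG.1 y.2 i, smul_zero])
    rw [map_smul, norm_smul, norm_inv, RCLike.norm_ofReal, abs_norm,
      inv_mul_lt_iff₀ (by positivity)] at h1
    simpa [mul_comm] using h1.le
  obtain ⟨g, hg, hgn⟩ := exists_extension_norm_eq G (ψ.comp G.subtypeL)
  have hgr : ‖g‖ ≤ r := by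
    rw [hgn]
    exact ContinuousLinearMap.opNorm_le_bound _ hr hbound
  have hker : ⨅ i, (L i : E →ₗ[𝕜] 𝕜).ker ≤ ((ψ - g : StrongDual 𝕜 E) : E →ₗ[𝕜] 𝕜).ker := by
    intro y hy
    have := hg ⟨y, hy⟩
    simp only [ContinuousLinearMap.comp_apply, Submodule.subtypeL_apply] at this
    simp [this]
  have hmem := mem_span_of_iInf_ker_le_ker hker
  have hspan : ψ - g ∈ Submodule.span 𝕜 (Set.range L) := by
    rw [Submodule.mem_span_range_iff_exists_fun] at hmem ⊢
    · obtain ⟨c, hc⟩ := hmem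
      refine ⟨c, ?_⟩
      ext y
      simpa using! LinearMap.congr_fun hc y
  have := h _ hspan
  rw [sub_sub_cancel] at this
  linarith

/-- The gliding hump. Each `x i` is annihilated by the earlier functionals `φ (s k)`, and the later
ones are negligible there because `∑ ‖φ j (x i)‖ ^ n` converges. -/
theorem WeaklyNull.exists_gliding_hump {φ : ℕ → StrongDual 𝕜 E} (hnull : WeaklyNull 𝕜 φ)
    (hnorm : ∀ j, ‖φ j‖ = 1) {n : ℕ} (hsum : ∀ x : E, Summable fun j => ‖φ j x‖ ^ n)
    {ε : ℝ} (hε : 0 < ε) :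
    ∃ (s : ℕ → ℕ) (x : ℕ → E), StrictMono s ∧ (∀ i, ‖x i‖ ≤ 1) ∧
      (∀ i, ∀ k < i, φ (s k) (x i) = 0) ∧ (∀ i, 1 / 4 ≤ ‖φ (s i) (x i)‖) ∧
      ∀ i, ∀ t : Finset ℕ, (∀ k ∈ t, i < k) → ∑ k ∈ t, ‖φ (s k) (x i)‖ ^ n ≤ ε := by
  have step : ∀ m : ℕ, ∃ (j : ℕ) (y : E) (N : ℕ), m ≤ j ∧ j < N ∧ ‖y‖ ≤ 1 ∧
      (∀ k < m, φ k y = 0) ∧ 1 / 4 ≤ ‖φ j y‖ ∧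
      ∀ t : Finset ℕ, (∀ k ∈ t, N ≤ k) → ∑ k ∈ t, ‖φ k y‖ ^ n ≤ ε := by
    intro m
    have : FiniteDimensional 𝕜 (Submodule.span 𝕜 (Set.range fun k : Fin m => φ k)) :=
      FiniteDimensional.span_of_finite 𝕜 (Set.finite_range _)
    obtain ⟨j, hj, hmj⟩ := ((hnull.eventually_lt_norm_sub hnorm
      (Submodule.span 𝕜 (Set.range fun k : Fin m => φ k))).and (eventually_ge_atTop m)).exists
    obtain ⟨y, hy, hy0, hyj⟩ :=
      exists_apply_eq_zero_of_lt_norm_sub (fun k : Fin m => φ k) (φ j) (by norm_num) hj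
    obtain ⟨u, hu⟩ := summable_iff_vanishing_norm.1 (hsum y) ε hε
    refine ⟨j, y, max (j + 1) (u.sup id + 1), hmj, by omega, hy, fun k hk => hy0 ⟨k, hk⟩, hyj,
      fun t ht => (le_abs_self _).trans (hu t ?_).le⟩
    rw [Finset.disjoint_left]
    intro k hkt hku
    have h1 := ht k hkt
    have h2 : k ≤ u.sup id := Finset.le_sup (f := id) hku
    omega
  choose j y N hmj hjN hy hy0 hyj htail using step
  let m : ℕ → ℕ := fun i => N^[i] 0
  have hm : ∀ i, m (i + 1) = N (m i) := fun i => Function.iterate_succ_apply' N i 0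
  have hs : StrictMono fun i => j (m i) := strictMono_nat_of_lt_succ fun i =>
    (hjN (m i)).trans_le ((hm i).symm.le.trans (hmj _))
  have hNj : ∀ i k, i < k → N (m i) ≤ j (m k) := fun i k hik =>
    ((hm i).symm.le.trans (hmj _)).trans (hs.monotone (Nat.succ_le_of_lt hik))
  refine ⟨fun i => j (m i), fun i => y (m i), hs, fun i => hy _, fun i k hk => ?_,
    fun i => hyj _, fun i t ht => ?_⟩
  · refine hy0 _ _ ?_
    have hmono : Monotone m := monotone_nat_of_le_succ fun i =>
      (hmj (m i)).trans ((hjN (m i)).le.trans (hm i).symm.le)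
    exact (hjN (m k)).trans_le ((hm k).symm.le.trans (hmono (Nat.succ_le_of_lt hk)))
  · have := htail (m i) (t.map ⟨fun k => j (m k), hs.injective⟩) (by
      intro k hk
      obtain ⟨l, hl, rfl⟩ := Finset.mem_map.1 hk
      exact hNj i l (ht l hl))
    simpa [Finset.sum_map] using this

end DualSequences

/-! ### Summability from upper estimates -/

section UpperEstimate

variable {𝕜 : Type*} [RCLike 𝕜] {F : Type*} [NormedAddCommGroup F] [NormedSpace 𝕜 F]

/-- By duality, an upper `q`-estimate makes every functional of the dual unit ball `p`-summable
along the sequence, with a uniform bound. -/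
theorem UpperEstimate.exists_sum_rpow_le {p q : ℝ} (hpq : p.HolderConjugate q) {x : ℕ → F}
    (h : UpperEstimate 𝕜 q x) :
    ∃ C : ℝ, 0 ≤ C ∧ ∀ f : StrongDual 𝕜 F, ‖f‖ ≤ 1 → ∀ t : Finset ℕ,
      ∑ j ∈ t, ‖f (x j)‖ ^ p ≤ C := by
  obtain ⟨B, hB, hest⟩ := h
  refine ⟨B ^ p, by positivity, fun f hf t => ?_⟩
  set S : ℝ := ∑ j ∈ t, ‖f (x j)‖ ^ p with hS
  have hS0 : 0 ≤ S := Finset.sum_nonneg fun j _ => by positivity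
  have hp := hpq.pos
  have hq := hpq.symm.pos
  have hp1 := hpq.lt
  rcases hS0.eq_or_lt with h0 | hSpos
  · rw [← h0]; positivity
  -- The coefficients `α j` with `α j * f (x j) = ‖f (x j)‖ ^ p` attain equality in Hölder.
  let α : ℕ → 𝕜 := fun j =>
    if j ∈ t then ((‖f (x j)‖ ^ (p - 2) : ℝ) : 𝕜) * (starRingEnd 𝕜) (f (x j)) else 0
  have hα : ∀ j ∈ t, α j * f (x j) = ((‖f (x j)‖ ^ p : ℝ) : 𝕜) := by
    intro j hj
    simp only [α, if_pos hj]
    rcases eq_or_ne (f (x j)) 0 with h0 | h0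
    · simp [h0, Real.zero_rpow hp.ne']
    · have hpos : 0 < ‖f (x j)‖ := norm_pos_iff.2 h0
      rw [mul_assoc, RCLike.conj_mul, ← RCLike.ofReal_pow, ← RCLike.ofReal_mul,
        ← Real.rpow_natCast, ← Real.rpow_add hpos]
      norm_num
  have hαn : ∀ j ∈ t, ‖α j‖ ^ q = ‖f (x j)‖ ^ p := by
    intro j hj
    simp only [α, if_pos hj]
    rcases eq_or_ne (f (x j)) 0 with h0 | h0
    · simp [h0, Real.zero_rpow hp.ne', Real.zero_rpow hq.ne']
    · have hpos : 0 < ‖f (x j)‖ := norm_pos_iff.2 h0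
      rw [norm_mul, RCLike.norm_conj, RCLike.norm_ofReal, abs_of_pos (by positivity)]
      nth_rewrite 2 [← Real.rpow_one ‖f (x j)‖]
      rw [← Real.rpow_add hpos, ← Real.rpow_mul hpos.le]
      congr 1
      have := hpq.sub_one_mul_conj
      linear_combination this
  obtain ⟨k, hk⟩ := t.exists_nat_subset_range
  have hα0 : ∀ j ∈ Finset.range k, j ∉ t → α j = 0 := fun j _ hj => if_neg hj
  have h1 : ∑ j ∈ Finset.range k, α j • x j = ∑ j ∈ t, α j • x j :=
    (Finset.sum_subset hk fun j hj hjt => by rw [hα0 j hj hjt, zero_smul]).symm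
  have h2 : ∑ j ∈ Finset.range k, ‖α j‖ ^ q = S := by
    rw [hS, ← Finset.sum_congr rfl hαn]
    exact (Finset.sum_subset hk fun j hj hjt => by
      rw [hα0 j hj hjt, norm_zero, Real.zero_rpow hq.ne']).symm
  have h3 : f (∑ j ∈ t, α j • x j) = ((S : ℝ) : 𝕜) := by
    rw [map_sum, hS, RCLike.ofReal_sum]
    exact Finset.sum_congr rfl fun j hj => by rw [map_smul, smul_eq_mul, hα j hj]
  have h4 : S ≤ ‖∑ j ∈ t, α j • x j‖ := by
    calc S = ‖f (∑ j ∈ t, α j • x j)‖ := by rw [h3, RCLike.norm_ofReal, abs_of_nonneg hS0]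
      _ ≤ _ := (f.le_opNorm _).trans (mul_le_of_le_one_left (norm_nonneg _) hf)
  have h5 : S ^ q ≤ B ^ q * S := by
    have := hest k α
    rw [h1, h2] at this
    exact (Real.rpow_le_rpow hS0 h4 hq.le).trans this
  have h6 : S ^ (q - 1) ≤ B ^ q := by
    rw [Real.rpow_sub_one hSpos.ne', div_le_iff₀ hSpos]
    exact h5
  have h7 := Real.rpow_le_rpow (by positivity) h6 (sub_nonneg.2 hp1.le)
  rw [← Real.rpow_mul hS0, ← Real.rpow_mul hB.le] at h7
  have e1 : (q - 1) * (p - 1) = 1 := by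
    have := hpq.mul_eq_add
    linarith
  have e2 : q * (p - 1) = p := by
    have := hpq.sub_one_mul_conj
    linarith
  rwa [e1, e2, Real.rpow_one] at h7

/-- For a sequence in the unit ball the exponent `p` may be raised to an integer `n ≥ p`. -/
theorem UpperEstimate.exists_sum_pow_le {p q : ℝ} (hpq : p.HolderConjugate q) {x : ℕ → F}
    (h : UpperEstimate 𝕜 q x) (hx : ∀ j, ‖x j‖ ≤ 1) {n : ℕ} (hn : p ≤ n) :
    ∃ C : ℝ, 0 ≤ C ∧ ∀ (f : StrongDual 𝕜 F) (t : Finset ℕ),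
      ∑ j ∈ t, ‖f (x j)‖ ^ n ≤ C * ‖f‖ ^ n := by
  obtain ⟨C, hC, hCle⟩ := h.exists_sum_rpow_le hpq
  have hn0 : n ≠ 0 := by
    rintro rfl
    exact (hpq.pos.trans_le hn).ne' (by simp)
  have unit : ∀ f : StrongDual 𝕜 F, ‖f‖ ≤ 1 → ∀ t : Finset ℕ, ∑ j ∈ t, ‖f (x j)‖ ^ n ≤ C := by
    intro f hf t
    refine (Finset.sum_le_sum fun j _ => ?_).trans (hCle f hf t)
    have h1 : ‖f (x j)‖ ≤ 1 :=
      (f.le_opNorm _).trans (mul_le_one₀ hf (norm_nonneg _) (hx j))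
    rw [← Real.rpow_natCast]
    exact Real.rpow_le_rpow_of_exponent_ge_of_imp (norm_nonneg _) h1 hn
      fun _ h0 => absurd h0 (Nat.cast_ne_zero.2 hn0)
  refine ⟨C, hC, fun f t => ?_⟩
  rcases eq_or_ne f 0 with rfl | hf
  · simp [hn0]
  have hf' : 0 < ‖f‖ := norm_pos_iff.2 hf
  have h1 := unit (((‖f‖ : 𝕜))⁻¹ • f)
    (by rw [norm_smul, norm_inv, RCLike.norm_ofReal, abs_norm, inv_mul_cancel₀ hf'.ne']) t
  simp only [smul_apply, norm_smul, norm_inv, RCLike.norm_ofReal, abs_norm,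
    mul_pow, ← Finset.mul_sum, inv_pow] at h1
  rw [inv_mul_le_iff₀ (by positivity)] at h1
  linarith

end UpperEstimate

/-! ### Scalar series with a dominant term -/

section SeriesBounds

variable {𝕜 : Type*} [RCLike 𝕜]

theorem norm_tsum_mul_le {a u : ℕ → 𝕜} {M C : ℝ} (ha : ∀ k, ‖a k‖ ≤ M)
    (hu : ∀ t : Finset ℕ, ∑ k ∈ t, ‖u k‖ ≤ C) :
    Summable (fun k => a k * u k) ∧ ‖∑' k, a k * u k‖ ≤ M * C := by
  have hM : 0 ≤ M := (norm_nonneg _).trans (ha 0)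
  have hle : ∀ t : Finset ℕ, ∑ k ∈ t, ‖a k * u k‖ ≤ M * C := fun t => by
    calc ∑ k ∈ t, ‖a k * u k‖ ≤ ∑ k ∈ t, M * ‖u k‖ :=
          Finset.sum_le_sum fun k _ => by rw [norm_mul]; gcongr; exact ha k
      _ = M * ∑ k ∈ t, ‖u k‖ := (Finset.mul_sum _ _ _).symm
      _ ≤ M * C := by gcongr; exact hu t
  have hs : Summable fun k => ‖a k * u k‖ :=
    summable_of_sum_le (fun k => norm_nonneg _) hle
  exact ⟨hs.of_norm, (norm_tsum_le_tsum_norm hs).trans (hs.tsum_le_of_sum_le hle)⟩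

/-- If `u` vanishes before `i` and is small after `i`, the `i`-th term dominates `∑ a k * u k`. -/
theorem sub_le_norm_tsum_mul {a u : ℕ → 𝕜} {M ε : ℝ} {i : ℕ} (ha : ∀ k, ‖a k‖ ≤ M)
    (hlow : ∀ k < i, u k = 0)
    (htail : ∀ t : Finset ℕ, (∀ k ∈ t, i < k) → ∑ k ∈ t, ‖u k‖ ≤ ε) :
    ‖a i‖ * ‖u i‖ - M * ε ≤ ‖∑' k, a k * u k‖ := by
  let v : ℕ → 𝕜 := fun k => if k = i then 0 else u k
  have hv : ∀ t : Finset ℕ, ∑ k ∈ t, ‖v k‖ ≤ ε := by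
    intro t
    have : ∑ k ∈ t, ‖v k‖ = ∑ k ∈ t with i < k, ‖u k‖ := by
      rw [Finset.sum_filter]
      refine Finset.sum_congr rfl fun k _ => ?_
      rcases lt_trichotomy k i with hk | rfl | hk
      · simp [v, hk.not_gt, hlow k hk]
      · simp [v]
      · simp [v, hk, hk.ne']
    rw [this]
    exact htail _ fun k hk => (Finset.mem_filter.1 hk).2
  obtain ⟨hs, hle⟩ := norm_tsum_mul_le ha hv
  have hsum : HasSum (fun k => a k * u k) (a i * u i + ∑' k, a k * v k) := by
    refine ((hasSum_ite_eq i (a i * u i)).add hs.hasSum).congr_fun fun k => ?_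
    rcases eq_or_ne k i with rfl | hk
    · simp [v]
    · simp [v, hk]
  rw [hsum.tsum_eq]
  have := norm_sub_le (a i * u i + ∑' k, a k * v k) (∑' k, a k * v k)
  rw [add_sub_cancel_right, norm_mul] at this
  linarith

end SeriesBounds

/-! ### The unit vectors of `c₀` -/

section ZeroAtInfty

variable (𝕜 : Type*) [RCLike 𝕜]

theorem ZeroAtInftyContinuousMap.norm_apply_le {𝕜 : Type*} [RCLike 𝕜] (a : C₀(ℕ, 𝕜)) (k : ℕ) :
    ‖a k‖ ≤ ‖a‖ :=
  a.toBCF.norm_coe_le_norm k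

/-- The unit vectors of `c₀`. -/
noncomputable def ZeroAtInftyContinuousMap.single (i : ℕ) : C₀(ℕ, 𝕜) where
  toFun := Pi.single i 1
  continuous_toFun := continuous_of_discreteTopology
  zero_at_infty' := by
    rw [cocompact_eq_cofinite, Nat.cofinite_eq_atTop]
    refine tendsto_const_nhds.congr' ((eventually_gt_atTop i).mono fun k hk => ?_)
    simp [hk.ne']

theorem ZeroAtInftyContinuousMap.single_apply (i k : ℕ) :
    ZeroAtInftyContinuousMap.single 𝕜 i k = (Pi.single i 1 : ℕ → 𝕜) k := rfl

end ZeroAtInfty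

/-! ### Sequences equivalent to the unit vector basis of `c₀` -/

section SequenceEquivalentToUnitVectors

variable {𝕜 : Type*} [RCLike 𝕜] {Y : Type*} [NormedAddCommGroup Y] [NormedSpace 𝕜 Y]

/-- The bound on finite sums makes `∑ a k • y k` unconditionally convergent for `a ∈ c₀`. -/
theorem summable_smul_of_norm_sum_le [CompleteSpace Y] {y : ℕ → Y} {C : ℝ}
    (hC : ∀ (t : Finset ℕ) (a : ℕ → 𝕜) (M : ℝ), 0 ≤ M → (∀ k ∈ t, ‖a k‖ ≤ M) →
      ‖∑ k ∈ t, a k • y k‖ ≤ C * M) (a : C₀(ℕ, 𝕜)) :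
    Summable fun k => a k • y k := by
  have hC0 : 0 ≤ C := by simpa using hC ∅ 0 1 zero_le_one
  rw [summable_iff_vanishing_norm]
  intro ε hε
  have hδ : 0 < ε / (2 * (C + 1)) := by positivity
  have hlim : Tendsto (fun k => a k) atTop (𝓝 0) := by
    have := a.zero_at_infty'
    rwa [cocompact_eq_cofinite, Nat.cofinite_eq_atTop] at this
  obtain ⟨N, hN⟩ := Metric.tendsto_atTop.1 hlim _ hδ
  refine ⟨Finset.range N, fun t ht => ?_⟩
  refine (hC t a _ hδ.le fun k hk => ?_).trans_lt ?_
  · have hNk : N ≤ k := by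
      by_contra hlt
      exact Finset.disjoint_left.1 ht hk (Finset.mem_range.2 (not_le.1 hlt))
    simpa using (hN k hNk).le
  · rw [← mul_div_assoc, div_lt_iff₀ (by positivity)]
    nlinarith

/-- A sequence with two-sided sup-norm estimates on its finite linear combinations is equivalent
to the unit vector basis of `c₀`. -/
theorem isBasicSequence_and_exists_c0_isomorphism [CompleteSpace Y] {y : ℕ → Y} {C c : ℝ}
    (hc : 0 < c)
    (hC : ∀ (t : Finset ℕ) (a : ℕ → 𝕜) (M : ℝ), 0 ≤ M → (∀ k ∈ t, ‖a k‖ ≤ M) →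
      ‖∑ k ∈ t, a k • y k‖ ≤ C * M)
    (hl : ∀ (t : Finset ℕ) (a : ℕ → 𝕜), ∀ i ∈ t, c * ‖a i‖ ≤ ‖∑ k ∈ t, a k • y k‖) :
    IsBasicSequence 𝕜 y ∧
      ∃ T : C₀(ℕ, 𝕜) →L[𝕜] Y, IsIsomorphicEmbedding T ∧
        (∀ a : C₀(ℕ, 𝕜), HasSum (fun j => a j • y j) (T a)) ∧
        LinearMap.range (T : C₀(ℕ, 𝕜) →ₗ[𝕜] Y) =
          (Submodule.span 𝕜 (Set.range y)).topologicalClosure := by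
  have hs := summable_smul_of_norm_sum_le hC
  let T : C₀(ℕ, 𝕜) →L[𝕜] Y := LinearMap.mkContinuous
    { toFun := fun a => ∑' k, a k • y k
      map_add' := fun a b => by
        simp only [ZeroAtInftyContinuousMap.add_apply, add_smul]
        exact (hs a).tsum_add (hs b)
      map_smul' := fun r a => by
        simp only [ZeroAtInftyContinuousMap.smul_apply, smul_eq_mul, mul_smul, RingHom.id_apply]
        exact (hs a).tsum_const_smul r } C fun a =>
      le_of_tendsto' (hs a).hasSum.norm fun t =>
        hC t a _ (norm_nonneg a) fun k _ => a.norm_apply_le k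
  have hT : ∀ a : C₀(ℕ, 𝕜), HasSum (fun k => a k • y k) (T a) := fun a => (hs a).hasSum
  have hcoord : ∀ (a : C₀(ℕ, 𝕜)) i, c * ‖a i‖ ≤ ‖T a‖ := fun a i =>
    ge_of_tendsto (hT a).norm ((eventually_ge_atTop {i}).mono fun t ht =>
      hl t a i (ht (Finset.mem_singleton_self i)))
  have hlower : ∀ a : C₀(ℕ, 𝕜), c * ‖a‖ ≤ ‖T a‖ := by
    intro a
    rw [mul_comm, ← le_div_iff₀ hc]
    refine (BoundedContinuousFunction.norm_le (f := a.toBCF) (by positivity)).2 fun i => ?_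
    rw [le_div_iff₀ hc, mul_comm]
    exact hcoord a i
  have hTsingle : ∀ i, T (ZeroAtInftyContinuousMap.single 𝕜 i) = y i := by
    intro i
    refine (hT _).unique ?_
    convert hasSum_single (f := fun k => ZeroAtInftyContinuousMap.single 𝕜 i k • y k) i ?_ using 1
    · simp [ZeroAtInftyContinuousMap.single_apply]
    · intro k hk
      simp [ZeroAtInftyContinuousMap.single_apply, hk]
  have hanti : AntilipschitzWith (c⁻¹).toNNReal T :=
    ContinuousLinearMap.antilipschitz_of_bound T fun a => by
      rw [Real.coe_toNNReal _ (inv_nonneg.2 hc.le), ← div_eq_inv_mul, le_div_iff₀ hc, mul_comm]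
      exact hlower a
  have hrange : LinearMap.range (T : C₀(ℕ, 𝕜) →ₗ[𝕜] Y) =
      (Submodule.span 𝕜 (Set.range y)).topologicalClosure := by
    apply le_antisymm
    · rintro _ ⟨a, rfl⟩
      exact mem_closure_of_tendsto (hT a) (Eventually.of_forall fun t =>
        Submodule.sum_mem _ fun k _ => Submodule.smul_mem _ _ (Submodule.subset_span ⟨k, rfl⟩))
    · refine Submodule.topologicalClosure_minimal _ (Submodule.span_le.2 ?_) ?_
      · rintro _ ⟨i, rfl⟩
        exact ⟨_, hTsingle i⟩
      · exact hanti.isClosed_range T.uniformContinuous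
  refine ⟨?_, T, ⟨c, hc, hlower⟩, hT, hrange⟩
  let V := (Submodule.span 𝕜 (Set.range y)).topologicalClosure
  -- The coordinate functionals are those of `c₀`, transported along `T`.
  have hpre : ∀ v : V, ∃ a, T a = v := fun v => by
    have : (v : Y) ∈ LinearMap.range (T : C₀(ℕ, 𝕜) →ₗ[𝕜] Y) := hrange ▸ v.2
    exact this
  choose R hR using hpre
  have hinj := hanti.injective
  let coord : ℕ → StrongDual 𝕜 V := fun i => LinearMap.mkContinuous
    { toFun := fun v => R v i
      map_add' := fun v w => by
        rw [← ZeroAtInftyContinuousMap.add_apply]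
        congr 1
        exact hinj (by rw [map_add, hR, hR, hR]; rfl)
      map_smul' := fun r v => by
        rw [RingHom.id_apply, ← ZeroAtInftyContinuousMap.smul_apply]
        congr 1
        exact hinj (by rw [map_smul, hR, hR]; rfl) } c⁻¹ fun v => by
      rw [← div_eq_inv_mul, le_div_iff₀ hc, mul_comm]
      have := hcoord (R v) i
      rwa [hR] at this
  let e : ℕ → V := fun j =>
    ⟨y j, Submodule.le_topologicalClosure _ (Submodule.subset_span ⟨j, rfl⟩)⟩
  have hRe : ∀ j, R (e j) = ZeroAtInftyContinuousMap.single 𝕜 j := fun j =>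
    hinj (by rw [hR, hTsingle])
  refine ⟨⟨e, coord, fun i j => ?_, fun v => ?_⟩, fun j => rfl⟩
  · change R (e j) i = _
    rw [hRe]
    simp [ZeroAtInftyContinuousMap.single_apply, Pi.single_apply]
  · have h1 : HasSum (fun i => coord i v • e i) v := by
      have h2 := hT (R v)
      rw [hR] at h2
      refine tendsto_subtype_rng.2 (h2.congr fun t => ?_)
      rw [Submodule.coe_sum]
      rfl
    exact h1.mono_left (SummationFilter.conditional ℕ).le_atTop

end SequenceEquivalentToUnitVectors

/-! ### Diagonal polynomials -/

section DiagonalPolynomials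

variable {𝕜 : Type*} [RCLike 𝕜] {E : Type*} [NormedAddCommGroup E] [NormedSpace 𝕜 E] {n : ℕ}

theorem prod_le_sum_pow_card {ι : Type*} [Fintype ι] [Nonempty ι] {r : ι → ℝ}
    (hr : ∀ i, 0 ≤ r i) : ∏ i, r i ≤ ∑ i, r i ^ Fintype.card ι := by
  obtain ⟨m, hm⟩ := Finite.exists_max r
  calc ∏ i, r i ≤ ∏ _i : ι, r m := Finset.prod_le_prod (fun i _ => hr i) fun i _ => hm i
    _ = r m ^ Fintype.card ι := by simp
    _ ≤ ∑ i, r i ^ Fintype.card ι :=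
        Finset.single_le_sum (f := fun i => r i ^ Fintype.card ι)
          (fun i _ => pow_nonneg (hr i) _) (Finset.mem_univ m)

/-- Multilinear form of the estimate on `∑ ‖ψ k x‖ ^ n`. -/
theorem sum_prod_norm_apply_le (hn : n ≠ 0) {ψ : ℕ → StrongDual 𝕜 E} {C : ℝ} (hC0 : 0 ≤ C)
    (hC : ∀ (x : E) (t : Finset ℕ), ∑ k ∈ t, ‖ψ k x‖ ^ n ≤ C * ‖x‖ ^ n)
    (v : Fin n → E) (t : Finset ℕ) :
    ∑ k ∈ t, ∏ i, ‖ψ k (v i)‖ ≤ n * C * ∏ i, ‖v i‖ := by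
  have : Nonempty (Fin n) := ⟨⟨0, Nat.pos_of_ne_zero hn⟩⟩
  let r : ℕ → Fin n → ℝ := fun k i => ‖ψ k (v i)‖ / ‖v i‖
  have hr0 : ∀ k i, 0 ≤ r k i := fun k i => by positivity
  have hr : ∀ k i, ‖ψ k (v i)‖ = r k i * ‖v i‖ := fun k i => by
    rcases eq_or_ne (v i) 0 with h0 | h0
    · simp [h0]
    · exact (div_mul_cancel₀ _ (norm_ne_zero_iff.2 h0)).symm
  have hrn : ∀ i, ∑ k ∈ t, r k i ^ n ≤ C := fun i => by
    simp only [r, div_pow, ← Finset.sum_div]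
    exact div_le_of_le_mul₀ (by positivity) hC0 (hC (v i) t)
  calc ∑ k ∈ t, ∏ i, ‖ψ k (v i)‖ = (∑ k ∈ t, ∏ i, r k i) * ∏ i, ‖v i‖ := by
        rw [Finset.sum_mul]
        exact Finset.sum_congr rfl fun k _ => by simp only [hr k, Finset.prod_mul_distrib]
    _ ≤ (∑ k ∈ t, ∑ i, r k i ^ n) * ∏ i, ‖v i‖ := by
        gcongr with k _
        simpa using prod_le_sum_pow_card (hr0 k)
    _ ≤ n * C * ∏ i, ‖v i‖ := by
        gcongr
        rw [Finset.sum_comm]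
        simpa using Finset.sum_le_sum fun i (_ : i ∈ Finset.univ) => hrn i

/-- For bounded `a`, the function `x ↦ ∑ a k * ψ k x ^ n` is a continuous `n`-homogeneous
polynomial. -/
theorem tsum_mul_apply_pow_mem_homPolySubmodule (hn : n ≠ 0) {ψ : ℕ → StrongDual 𝕜 E} {C : ℝ}
    (hC0 : 0 ≤ C) (hC : ∀ (x : E) (t : Finset ℕ), ∑ k ∈ t, ‖ψ k x‖ ^ n ≤ C * ‖x‖ ^ n)
    {a : ℕ → 𝕜} {M : ℝ} (ha : ∀ k, ‖a k‖ ≤ M) :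
    (fun x : E => ∑' k, a k * ψ k x ^ n) ∈ homPolySubmodule 𝕜 n E := by
  let m : ℕ → MultilinearMap 𝕜 (fun _ : Fin n => E) 𝕜 := fun k =>
    (MultilinearMap.mkPiAlgebra 𝕜 (Fin n) 𝕜).compLinearMap fun _ => (ψ k : E →ₗ[𝕜] 𝕜)
  have hm : ∀ k v, m k v = ∏ i, ψ k (v i) := fun k v => by simp [m]
  have hbd : ∀ (v : Fin n → E) (t : Finset ℕ), ∑ k ∈ t, ‖m k v‖ ≤ n * C * ∏ i, ‖v i‖ := by
    intro v t
    simp only [hm, norm_prod]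
    exact sum_prod_norm_apply_le hn hC0 hC v t
  have hs : ∀ v : Fin n → E, Summable fun k => a k * m k v := fun v =>
    (norm_tsum_mul_le ha (hbd v)).1
  let A : MultilinearMap 𝕜 (fun _ : Fin n => E) 𝕜 :=
    { toFun := fun v => ∑' k, a k * m k v
      map_update_add' := fun v i x y => by
        simp only [MultilinearMap.map_update_add, mul_add]
        exact (hs _).tsum_add (hs _)
      map_update_smul' := fun v i c x => by
        simp only [MultilinearMap.map_update_smul, smul_eq_mul, mul_left_comm _ c]
        exact tsum_mul_left }
  refine ⟨A.mkContinuous (M * (n * C)) fun v => ?_, fun x => ?_⟩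
  · rw [mul_assoc]
    exact (norm_tsum_mul_le ha (hbd v)).2
  · change _ = ∑' k, a k * m k fun _ => x
    simp [hm]

/-- The diagonal polynomials `∑ a k * ψ k ^ n` form a copy of `ℓ_∞`, as soon as there are points
`x i` of the unit ball at which the `i`-th term dominates. -/
theorem exists_lpInfty_embedding_homPoly (hn : n ≠ 0) {ψ : ℕ → StrongDual 𝕜 E} {C : ℝ}
    (hC0 : 0 ≤ C) (hC : ∀ (x : E) (t : Finset ℕ), ∑ k ∈ t, ‖ψ k x‖ ^ n ≤ C * ‖x‖ ^ n)
    {x : ℕ → E} (hx : ∀ i, ‖x i‖ ≤ 1) {δ ε : ℝ} (hε : ε < δ)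
    (hlow : ∀ i, ∀ k < i, ψ k (x i) = 0) (hdiag : ∀ i, δ ≤ ‖ψ i (x i)‖ ^ n)
    (htail : ∀ i, ∀ t : Finset ℕ, (∀ k ∈ t, i < k) → ∑ k ∈ t, ‖ψ k (x i)‖ ^ n ≤ ε) :
    ∃ S : lp (fun _ : ℕ => 𝕜) ∞ →L[𝕜] HomPoly 𝕜 n E, IsIsomorphicEmbedding S := by
  have ha : ∀ (a : lp (fun _ : ℕ => 𝕜) ∞) k, ‖a k‖ ≤ ‖a‖ :=
    fun a k => lp.norm_apply_le_norm ENNReal.top_ne_zero a k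
  have hsum : ∀ (a : lp (fun _ : ℕ => 𝕜) ∞) (y : E),
      Summable (fun k => a k * ψ k y ^ n) ∧ ‖∑' k, a k * ψ k y ^ n‖ ≤ ‖a‖ * (C * ‖y‖ ^ n) :=
    fun a y => norm_tsum_mul_le (ha a) fun t => by simpa only [norm_pow] using hC y t
  let P : lp (fun _ : ℕ => 𝕜) ∞ → HomPoly 𝕜 n E := fun a =>
    ⟨_, tsum_mul_apply_pow_mem_homPolySubmodule hn hC0 hC (ha a)⟩
  have hP : ∀ a y, P a y = ∑' k, a k * ψ k y ^ n := fun a y => rfl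
  have hball : Nonempty (Metric.closedBall (0 : E) 1) := ⟨⟨0, by simp⟩⟩
  let S : lp (fun _ : ℕ => 𝕜) ∞ →L[𝕜] HomPoly 𝕜 n E := LinearMap.mkContinuous
    { toFun := P
      map_add' := fun a b => Subtype.ext (funext fun y => by
        refine Eq.trans ?_ ((hsum a y).1.tsum_add (hsum b y).1)
        exact tsum_congr fun k => by rw [← add_mul]; rfl)
      map_smul' := fun c a => Subtype.ext (funext fun y => by
        refine Eq.trans ?_ (tsum_mul_left (a := c))
        exact tsum_congr fun k => by rw [← mul_assoc]; rfl) } C fun a => by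
      refine ciSup_le fun y => ?_
      have hy : ‖(y : E)‖ ≤ 1 := mem_closedBall_zero_iff.1 y.2
      calc ‖P a y‖ ≤ ‖a‖ * (C * ‖(y : E)‖ ^ n) := (hsum a y).2
        _ ≤ ‖a‖ * (C * 1) := by gcongr; exact pow_le_one₀ (norm_nonneg _) hy
        _ = C * ‖a‖ := by ring
  have hδε : 0 < δ - ε := sub_pos.2 hε
  have hδ : 0 < δ := (by simpa using htail 0 ∅ (by simp) : 0 ≤ ε).trans_lt hε
  refine ⟨S, δ - ε, hδε, fun a => ?_⟩
  have hi : ∀ i, ‖a i‖ * δ - ‖a‖ * ε ≤ ‖S a‖ := by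
    intro i
    have h1 := sub_le_norm_tsum_mul (u := fun k => ψ k (x i) ^ n) (ha a)
      (fun k hk => by simp [hlow i k hk, hn])
      (fun t ht => by simpa only [norm_pow] using htail i t ht)
    have h2 : ‖P a (x i)‖ ≤ ‖S a‖ := le_ciSup (P a).bddAbove ⟨x i, by simpa using hx i⟩
    have h3 : ‖a i‖ * δ ≤ ‖a i‖ * ‖ψ i (x i) ^ n‖ := by
      rw [norm_pow]; gcongr; exact hdiag i
    rw [hP] at h2
    linarith
  have hε0 : 0 ≤ ε := by simpa using htail 0 ∅ (by simp)
  have hle : ‖a‖ ≤ (‖S a‖ + ‖a‖ * ε) / δ :=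
    lp.norm_le_of_forall_le (by positivity) fun i => by
      rw [le_div_iff₀ hδ]
      linarith [hi i]
  rw [le_div_iff₀ hδ] at hle
  linarith

end DiagonalPolynomials

/-! ### Injective norms of sums of tensor powers -/

section TensorPowers

variable {𝕜 : Type*} [RCLike 𝕜] {F : Type*} [NormedAddCommGroup F] [NormedSpace 𝕜 F] {n : ℕ}

theorem InjSymTensor.norm_sum_smul_pow (t : Finset ℕ) (a : ℕ → 𝕜) (y : ℕ → F) :
    ‖∑ k ∈ t, a k • InjSymTensor.pow 𝕜 n (y k)‖ =
      ⨆ f : Metric.closedBall (0 : StrongDual 𝕜 F) 1, ‖∑ k ∈ t, a k * f.1 (y k) ^ n‖ := by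
  have h : ∑ k ∈ t, a k • InjSymTensor.pow 𝕜 n (y k) =
      ((∑ k ∈ t, a k • SymTensor.pow 𝕜 n (y k) : SymTensor 𝕜 n F) :
        UniformSpace.Completion (SymTensor 𝕜 n F)) := by
    rw [← UniformSpace.Completion.coe_toComplₗᵢ (𝕜 := 𝕜), map_sum]
    exact Finset.sum_congr rfl fun k _ => by rw [map_smul]; rfl
  rw [h, UniformSpace.Completion.norm_coe, SymTensor.norm_def]
  simp only [map_sum, map_smul, SymTensor.eval_pow, smul_eq_mul]

theorem InjSymTensor.norm_sum_smul_pow_le {y : ℕ → F} {C : ℝ}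
    (hC0 : 0 ≤ C)
    (hC : ∀ (f : StrongDual 𝕜 F) (t : Finset ℕ), ∑ k ∈ t, ‖f (y k)‖ ^ n ≤ C * ‖f‖ ^ n)
    (t : Finset ℕ) (a : ℕ → 𝕜) {M : ℝ} (hM : 0 ≤ M) (ha : ∀ k ∈ t, ‖a k‖ ≤ M) :
    ‖∑ k ∈ t, a k • InjSymTensor.pow 𝕜 n (y k)‖ ≤ C * M := by
  have : Nonempty (Metric.closedBall (0 : StrongDual 𝕜 F) 1) := ⟨⟨0, by simp⟩⟩
  rw [InjSymTensor.norm_sum_smul_pow]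
  refine ciSup_le fun f => ?_
  have hf : ‖f.1‖ ≤ 1 := mem_closedBall_zero_iff.1 f.2
  calc ‖∑ k ∈ t, a k * f.1 (y k) ^ n‖ ≤ ∑ k ∈ t, ‖f.1 (y k)‖ ^ n * M :=
        norm_sum_le_of_le _ fun k hk => by
          rw [norm_mul, norm_pow, mul_comm]
          gcongr
          exact ha k hk
    _ = (∑ k ∈ t, ‖f.1 (y k)‖ ^ n) * M := (Finset.sum_mul _ _ _).symm
    _ ≤ C * 1 * M := by
        gcongr
        exact (hC f.1 t).trans (by gcongr; exact pow_le_one₀ (norm_nonneg _) hf)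
    _ = C * M := by ring

/-- The lower sup-norm estimate for the tensors `(y k) ^ n`, by evaluation at the functionals
`f i`; it suffices to treat an index where `‖a i‖` is maximal. -/
theorem InjSymTensor.le_norm_sum_smul_pow (hn : n ≠ 0) {y : ℕ → F} {f : ℕ → StrongDual 𝕜 F}
    (hf : ∀ i, ‖f i‖ ≤ 1) {δ ε : ℝ} (hε : ε < δ) (hlow : ∀ i, ∀ k < i, f i (y k) = 0)
    (hdiag : ∀ i, δ ≤ ‖f i (y i)‖ ^ n)
    (htail : ∀ i, ∀ t : Finset ℕ, (∀ k ∈ t, i < k) → ∑ k ∈ t, ‖f i (y k)‖ ^ n ≤ ε)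
    (t : Finset ℕ) (a : ℕ → 𝕜) (i : ℕ) (hi : i ∈ t) :
    (δ - ε) * ‖a i‖ ≤ ‖∑ k ∈ t, a k • InjSymTensor.pow 𝕜 n (y k)‖ := by
  obtain ⟨j, hj, hmax⟩ := t.exists_max_image (fun k => ‖a k‖) ⟨i, hi⟩
  have hb : ∀ k, ‖if k ∈ t then a k else 0‖ ≤ ‖a j‖ := fun k => by
    split_ifs with hk
    · exact hmax k hk
    · simp
  have h1 := sub_le_norm_tsum_mul (u := fun k => f j (y k) ^ n) hb
    (fun k hk => by simp [hlow j k hk, hn])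
    (fun s hs => by simpa only [norm_pow] using htail j s hs)
  rw [tsum_eq_sum (s := t) fun k hk => by simp [hk], if_pos hj,
    Finset.sum_congr rfl fun k hk => by rw [if_pos hk]] at h1
  have h2 : ‖∑ k ∈ t, a k * f j (y k) ^ n‖ ≤
      ‖∑ k ∈ t, a k • InjSymTensor.pow 𝕜 n (y k)‖ := by
    rw [InjSymTensor.norm_sum_smul_pow]
    have hbdd := (∑ k ∈ t, a k • SymTensor.pow 𝕜 n (y k) : SymTensor 𝕜 n F).bddAbove
    simp only [map_sum, map_smul, SymTensor.eval_pow, smul_eq_mul] at hbdd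
    exact le_ciSup hbdd ⟨f j, by simpa using hf j⟩
  have h3 : ‖a j‖ * δ ≤ ‖a j‖ * ‖f j (y j) ^ n‖ := by
    rw [norm_pow]; gcongr; exact hdiag j
  have h4 : (δ - ε) * ‖a i‖ ≤ (δ - ε) * ‖a j‖ := by
    have := sub_pos.2 hε
    gcongr
    exact hmax i hi
  linarith

end TensorPowers

/-! ### Copies of `ℓ_∞` and `c₀` -/

theorem proposition6 {𝕜 : Type*} [RCLike 𝕜] {E : Type*} [NormedAddCommGroup E]
    [NormedSpace 𝕜 E] [CompleteSpace E] {p q : ℝ} (hpq : p.HolderConjugate q)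
    (φ : ℕ → StrongDual 𝕜 E) (hnorm : ∀ j, ‖φ j‖ = 1) (hnull : WeaklyNull 𝕜 φ)
    (hupper : UpperEstimate 𝕜 q φ) (n : ℕ) (hn : p ≤ n) :
    -- `l_∞` embeds in `𝒫(ⁿE)`
    (∃ S : lp (fun _ : ℕ => 𝕜) ∞ →L[𝕜] HomPoly 𝕜 n E, IsIsomorphicEmbedding S) ∧
    -- some subsequence of `(φⱼⁿ)` is a basic sequence in the completed injective symmetric tensor
    -- product of `E'`, and its closed span is a copy of `c₀` with the `φⱼⁿ` as unit vector basis
    ∃ s : ℕ → ℕ, StrictMono s ∧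
      IsBasicSequence 𝕜 (fun j => InjSymTensor.pow 𝕜 n (φ (s j))) ∧
      ∃ T : C₀(ℕ, 𝕜) →L[𝕜] InjSymTensor 𝕜 n (StrongDual 𝕜 E),
        IsIsomorphicEmbedding T ∧
        (∀ a : C₀(ℕ, 𝕜), HasSum (fun j => a j • InjSymTensor.pow 𝕜 n (φ (s j))) (T a)) ∧
        LinearMap.range (T : C₀(ℕ, 𝕜) →ₗ[𝕜] InjSymTensor 𝕜 n (StrongDual 𝕜 E)) =
          (Submodule.span 𝕜
            (Set.range fun j => InjSymTensor.pow 𝕜 n (φ (s j)))).topologicalClosure := by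
  have hn0 : n ≠ 0 := by
    rintro rfl
    exact (hpq.pos.trans_le hn).ne' (by simp)
  obtain ⟨C, hC0, hC⟩ := hupper.exists_sum_pow_le hpq (fun j => (hnorm j).le) hn
  -- Points of `E` act on `E'` through the canonical embedding `J` into the bidual.
  let J := NormedSpace.inclusionInDoubleDual 𝕜 E
  have hJ : ∀ x, ‖J x‖ ≤ ‖x‖ := NormedSpace.double_dual_bound 𝕜 E
  have hCE : ∀ (x : E) (t : Finset ℕ), ∑ j ∈ t, ‖φ j x‖ ^ n ≤ C * ‖x‖ ^ n := fun x t =>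
    (hC (J x) t).trans (by gcongr; exact hJ x)
  have hδ : (0 : ℝ) < (1 / 4) ^ n := by positivity
  obtain ⟨s, x, hs, hx, hlow, hdiag, htail⟩ := hnull.exists_gliding_hump hnorm
    (fun x => summable_of_sum_le (fun j => by positivity) (hCE x)) (half_pos hδ)
  have hsub : ∀ (f : StrongDual 𝕜 (StrongDual 𝕜 E)) (t : Finset ℕ),
      ∑ k ∈ t, ‖f (φ (s k))‖ ^ n ≤ C * ‖f‖ ^ n := fun f t => by
    simpa [Finset.sum_map] using hC f (t.map ⟨s, hs.injective⟩)
  have hdiag' : ∀ i, (1 / 4 : ℝ) ^ n ≤ ‖φ (s i) (x i)‖ ^ n := fun i => by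
    gcongr
    exact hdiag i
  refine ⟨exists_lpInfty_embedding_homPoly hn0 hC0 (ψ := fun k => φ (s k))
    (fun y t => (hsub (J y) t).trans (by gcongr; exact hJ y)) hx (half_lt_self hδ) hlow hdiag'
    htail, s, hs, ?_⟩
  exact isBasicSequence_and_exists_c0_isomorphism (sub_pos.2 (half_lt_self hδ))
    (fun t a M hM ha => InjSymTensor.norm_sum_smul_pow_le hC0 hsub t a hM ha)
    (InjSymTensor.le_norm_sum_smul_pow hn0 (f := fun i => J (x i))
      (fun i => (hJ _).trans (hx i)) (half_lt_self hδ) hlow hdiag' htail)
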